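/- Let $\mathbb{T}\subseteq\mathbb{R}$ be an interval (for instance $[0,T]$, $[0,\infty)$ or $(-\infty,\infty)$), let $\Theta\subset\mathbb{R}^d$ be open, convex and bounded, and for each $\vartheta\in\Theta$ let $\lambda(\vartheta,\cdot)\ge 0$ be a locally integrable function on $\mathbb{T}$. Fix a true value $\vartheta_0\in\Theta$ and let $X_1,X_2,\dots$ be independent Poisson processes on $\mathbb{T}$ with intensity function $\lambda(\vartheta_0,\cdot)$; that is, each $X_j=(X_j(t),t\in\mathbb{T})$ is a counting process with independent increments such that $X_j(t_2)-X_j(t_1)$ has the Poisson distribution with mean $\int_{t_1}^{t_2}\lambda(\vartheta_0,s)\,ds$ for all $t_1<t_2$ in $\mathbb{T}$. Let $\mathbf g=(g_1,\dots,g_d):\mathbb{T}\to\mathbb{R}^d$ be a measurable function such that the integrals $$\mathbf M(\vartheta)=\int_{\mathbb{T}}\mathbf g(s)\,\lambda(\vartheta,s)\,ds\quad(\vartheta\in\Theta),\qquad \mathbf G(\vartheta_0)_{lk}=\int_{\mathbb{T}}g_l(s)g_k(s)\lambda(\vartheta_0,s)\,ds\quad(1\le l,k\le d)$$ converge absolutely.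 Suppose that $\mathbf M$ is injective on $\Theta$, with inverse function $\mathbf H$, so that $\mathbf H(\mathbf M(\vartheta))=\vartheta$ for all $\vartheta\in\Theta$, and that 1. for every $\nu>0$ and every $\vartheta'\in\Theta$, $\displaystyle\inf_{\vartheta\in\Theta,\ |\vartheta-\vartheta'|>\nu}|\mathbf M(\vartheta)-\mathbf M(\vartheta')|>0$; 2. $\mathbf H$ is continuously differentiable on an open set containing $\mathbf M(\Theta)$ (outside this set $\mathbf H$ is extended to $\mathbb{R}^d$ by any measurable function). Let $\vartheta_n^*=\mathbf H(\mathbf a_n)$ be the method of moments estimator, where $\mathbf a_n=\frac1n\sum_{j=1}^n\int_{\mathbb{T}}\mathbf g(s)\,dX_j(s)$. Then, as $n\to\infty$, $\vartheta_n^*$ is consistent, i.e. $\vartheta_n^*\to\vartheta_0$ in probability, and asymptotically normal: $$\sqrt n\,(\vartheta_n^*-\vartheta_0)\Longrightarrow\mathcal N\bigl(0,\mathbf D(\vartheta_0)\bigr),\qquad \mathbf D(\vartheta_0)=\mathbf H'(\mathbf M(\vartheta_0))\,\mathbf G(\vartheta_0)\,\mathbf H'(\mathbf M(\vartheta_0))^{T},$$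 where $\mathbf H'(a)=\bigl(\partial H_l(a)/\partial a_k\bigr)_{lk}$ is the Jacobian matrix of $\mathbf H$ at $a$. -/

import Mathlib

open MeasureTheory ProbabilityTheory Filter Topology

/-- Closed bounded intervals of an interval of the real line are compact. -/
instance ordConnected_compactIccSpace (T : Set ℝ) [hT : T.OrdConnected] : CompactIccSpace T where
  isCompact_Icc {a b} := by
    rw [Subtype.isCompact_iff]
    have h : ((↑) : T → ℝ) '' Set.Icc a b = Set.Icc (a : ℝ) (b : ℝ) := by
      ext x
      constructor
      · rintro ⟨y, hy, rfl⟩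
        exact ⟨hy.1, hy.2⟩
      · intro hx
        exact ⟨⟨x, hT.out a.2 b.2 hx⟩, ⟨hx.1, hx.2⟩, rfl⟩
    rw [h]
    exact isCompact_Icc

/-- Path of a counting process on the interval `T`: a nondecreasing right-continuous function
whose increments are nonnegative integers, and which starts from `0` at the left end of `T` if
that end belongs to `T`. (If `T` has no least element, the path is determined by its increments
up to an additive constant, on which the integrals below do not depend.) -/
structure CountingPath (T : Set ℝ) extends StieltjesFunction T where
  exists_nat : ∀ s t : T, s ≤ t → ∃ k : ℕ, toFun t - toFun s = k
  eq_zero : ∀ t : T, IsBot t → toFun t = 0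

/-- The Lebesgue–Stieltjes integral `∫_T g(s) dX(s)` along a counting path. -/
noncomputable def CountingPath.integral {T : Set ℝ} [T.OrdConnected]
    {E : Type*} [NormedAddCommGroup E] [NormedSpace ℝ E]
    (x : CountingPath T) (g : ℝ → E) : E :=
  ∫ s : T, g s ∂x.toStieltjesFunction.measure

/-- An intensity function on `T`: nonnegative, and integrable over compact subintervals. -/
structure IsIntensity (T : Set ℝ) (lam : ℝ → ℝ) : Prop where
  nonneg : ∀ t ∈ T, 0 ≤ lam t
  locallyIntegrableOn : LocallyIntegrableOn lam T

/-- `X` is an inhomogeneous Poisson process on `T` with intensity function `lam`: a counting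
process with independent increments such that `X(t) - X(s)` has the Poisson distribution with
mean `∫_s^t lam(u) du` for all `s ≤ t` in `T`. -/
structure IsPoissonProcess {Ω : Type*} [MeasurableSpace Ω] {T : Set ℝ}
    (X : Ω → CountingPath T) (lam : ℝ → ℝ) (P : Measure Ω) : Prop where
  measurable : ∀ t : T, Measurable fun ω => (X ω).toFun t
  indep_increments : HasIndepIncrements (fun (t : T) ω => (X ω).toFun t) P
  law_increments : ∀ s t : T, s ≤ t →
    HasLaw (fun ω => (X ω).toFun t - (X ω).toFun s)
      ((poissonMeasure (∫ u in (s : ℝ)..t, lam u).toNNReal).map ((↑) : ℕ → ℝ)) P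

section MethodOfMoments

variable {d : ℕ}

/-- `M(ϑ) = ∫_T g(s) λ(ϑ, s) ds`. -/
noncomputable def momentMap (T : Set ℝ) (lam : EuclideanSpace ℝ (Fin d) → ℝ → ℝ)
    (g : ℝ → EuclideanSpace ℝ (Fin d)) (θ : EuclideanSpace ℝ (Fin d)) :
    EuclideanSpace ℝ (Fin d) :=
  ∫ s in T, lam θ s • g s

/-- `G(ϑ)_{lk} = ∫_T g_l(s) g_k(s) λ(ϑ, s) ds`. -/
noncomputable def momentCov (T : Set ℝ) (lam : EuclideanSpace ℝ (Fin d) → ℝ → ℝ)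
    (g : ℝ → EuclideanSpace ℝ (Fin d)) (θ : EuclideanSpace ℝ (Fin d)) :
    Matrix (Fin d) (Fin d) ℝ :=
  Matrix.of fun l k => ∫ s in T, g s l * g s k * lam θ s

/-- The Jacobian matrix `(∂H_l/∂a_k)(a)`. -/
noncomputable def jacobian (H : EuclideanSpace ℝ (Fin d) → EuclideanSpace ℝ (Fin d))
    (a : EuclideanSpace ℝ (Fin d)) : Matrix (Fin d) (Fin d) ℝ :=
  Matrix.of fun l k => fderiv ℝ H a (EuclideanSpace.single k 1) l

/-- `D(ϑ) = H'(M(ϑ)) G(ϑ) H'(M(ϑ))ᵀ`. -/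
noncomputable def limitCov (T : Set ℝ) (lam : EuclideanSpace ℝ (Fin d) → ℝ → ℝ)
    (g : ℝ → EuclideanSpace ℝ (Fin d))
    (H : EuclideanSpace ℝ (Fin d) → EuclideanSpace ℝ (Fin d))
    (θ : EuclideanSpace ℝ (Fin d)) : Matrix (Fin d) (Fin d) ℝ :=
  jacobian H (momentMap T lam g θ) * momentCov T lam g θ *
    (jacobian H (momentMap T lam g θ)).transpose

/-- `a_n = (1/n) ∑_{j<n} ∫_T g dX_j`. -/
noncomputable def empiricalMoment {Ω : Type*} {T : Set ℝ} [T.OrdConnected]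
    (X : ℕ → Ω → CountingPath T) (g : ℝ → EuclideanSpace ℝ (Fin d)) (n : ℕ) (ω : Ω) :
    EuclideanSpace ℝ (Fin d) :=
  (n : ℝ)⁻¹ • ∑ j ∈ Finset.range n, (X j ω).integral g

/-- The method of moments estimator `ϑ*_n = H(a_n)`. -/
noncomputable def momentEstimator {Ω : Type*} {T : Set ℝ} [T.OrdConnected]
    (X : ℕ → Ω → CountingPath T) (g : ℝ → EuclideanSpace ℝ (Fin d))
    (H : EuclideanSpace ℝ (Fin d) → EuclideanSpace ℝ (Fin d)) (n : ℕ) (ω : Ω) :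
    EuclideanSpace ℝ (Fin d) :=
  H (empiricalMoment X g n ω)

/-- The regularity conditions on `M` and on its inverse function `H`. The function `H` is the
inverse of `M` on the set `M(Θ)` of values of `M`, and it is continuously differentiable on an
open set `U` containing `M(Θ)` (which may be `M(Θ)` itself if that set is open). The infimum is
taken in `[0, ∞]`, so that it is `∞` over the empty set. -/
structure RegularityConditions (Θ : Set (EuclideanSpace ℝ (Fin d)))
    (M H : EuclideanSpace ℝ (Fin d) → EuclideanSpace ℝ (Fin d)) : Prop where
  leftInvOn : Set.LeftInvOn H M Θ
  identifiable : ∀ ν : ℝ, 0 < ν → ∀ θ₀ ∈ Θ,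
    0 < ⨅ θ ∈ {θ ∈ Θ | ν < ‖θ - θ₀‖}, ‖M θ - M θ₀‖ₑ
  contDiffOn : ∃ U : Set (EuclideanSpace ℝ (Fin d)), IsOpen U ∧ M '' Θ ⊆ U ∧ ContDiffOn ℝ 1 H U

end MethodOfMoments

/-! The estimator is `H` of the mean of the vectors `∫ g dX_j`. If these are i.i.d. and square
integrable with mean `M(ϑ₀)` and covariance `G(ϑ₀)`, then the strong law puts `a_n` near `M(ϑ₀)`
almost surely. Continuity of `H` there gives consistency, and the central limit theorem with the
delta method gives normality: the derivative of `H` at `M(ϑ₀)` carries `N(0, G)` to `N(0, H' G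
H'ᵀ)`.

The work lies in the hypothesis on the vectors, since a Poisson process is given only through its
increments. These determine the random counting measure, so the integral is a measurable function of
the recentred path. Hence independence passes to the integrals, and their common law follows from
the laws of the increments (`HasIndepIncrements.map_sub_eq`).

Mean and covariance are Campbell's formulas. Each is an equality of two measures on `T`, checked on
half-open intervals, where it is a computation with Poisson moments; the second-moment formula needs
this twice, once per argument (`lintegral_lintegral_mul_lintegral`). -/

/-! ### Measures determined by half-open intervals -/

section HalfOpenIntervals

variable {α : Type*} [LinearOrder α] [TopologicalSpace α] [OrderTopology α]
  [SecondCountableTopology α]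

/-- A second countable linear order is exhausted, up to its bottom element, by an increasing
sequence of half-open intervals. -/
lemma exists_monotone_Ioc_exhaustion (α : Type*) [LinearOrder α] [TopologicalSpace α]
    [OrderTopology α] [SecondCountableTopology α] [Nonempty α] :
    ∃ u v : ℕ → α, Monotone (fun n => Set.Ioc (u n) (v n)) ∧
      (⋃ n, Set.Ioc (u n) (v n))ᶜ ⊆ botSet := by
  obtain ⟨u, hu, hu'⟩ := exists_seq_antitone_tendsto_atTop_atBot α
  obtain ⟨v, hv, hv'⟩ := exists_seq_monotone_tendsto_atTop_atTop α
  refine ⟨u, v, fun m n h => Set.Ioc_subset_Ioc (hu h) (hv h), fun x hx => ?_⟩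
  by_contra hbot
  obtain ⟨y, hy⟩ : ∃ y, y < x := by simpa [botSet, IsBot] using hbot
  obtain ⟨n, h₁, h₂⟩ :=
    ((hu'.eventually (eventually_le_atBot y)).and (hv'.eventually (eventually_ge_atTop x))).exists
  exact hx (Set.mem_iUnion.2 ⟨n, h₁.trans_lt hy, h₂⟩)

variable [MeasurableSpace α] [BorelSpace α]

/-- Two measures that do not charge the bottom element and agree on the half-open intervals, where
they are finite, are equal. -/
lemma MeasureTheory.Measure.ext_of_Ioc_of_botSet {μ ν : Measure α}
    (hμ : μ botSet = 0) (hν : ν botSet = 0) (hfin : ∀ a b, μ (Set.Ioc a b) ≠ ⊤)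
    (h : ∀ a b, a ≤ b → μ (Set.Ioc a b) = ν (Set.Ioc a b)) : μ = ν := by
  rcases isEmpty_or_nonempty α with hα | hα
  · exact Subsingleton.elim _ _
  obtain ⟨u, v, -, huv⟩ := exists_monotone_Ioc_exhaustion α
  -- The index `none` stands for the bottom element, which no half-open interval contains and where
  -- both measures vanish.
  have hcover : ⋃ n : Option ℕ, (n.elim botSet fun n => Set.Ioc (u n) (v n)) = Set.univ := by
    rw [Set.eq_univ_iff_forall]
    intro x
    by_cases hx : x ∈ ⋃ n, Set.Ioc (u n) (v n)
    · obtain ⟨n, hn⟩ := Set.mem_iUnion.1 hx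
      exact Set.mem_iUnion.2 ⟨some n, hn⟩
    · exact Set.mem_iUnion.2 ⟨none, huv hx⟩
  rw [Measure.ext_iff_of_iUnion_eq_univ hcover]
  rintro (_ | n)
  · simp [Measure.restrict_eq_zero.2 hμ, Measure.restrict_eq_zero.2 hν]
  · have : IsFiniteMeasure (μ.restrict (Set.Ioc (u n) (v n))) :=
      ⟨by simpa using (hfin (u n) (v n)).lt_top⟩
    refine Measure.ext_of_Iic (μ.restrict (Set.Ioc (u n) (v n)))
      (ν.restrict (Set.Ioc (u n) (v n))) fun a => ?_
    simp only [Measure.restrict_apply measurableSet_Iic]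
    rw [Set.inter_comm, Set.Ioc_inter_Iic]
    rcases le_total (u n) (v n ⊓ a) with hle | hle
    · exact h _ _ hle
    · simp [Set.Ioc_eq_empty hle.not_gt]

/-- A random measure is measurable if the masses of half-open intervals are. -/
lemma measurable_measure_of_Ioc {Ω : Type*} [MeasurableSpace Ω] {μ : Ω → Measure α}
    (hbot : ∀ ω, μ ω botSet = 0) (hfin : ∀ ω a b, μ ω (Set.Ioc a b) ≠ ⊤)
    (h : ∀ a b, Measurable fun ω => μ ω (Set.Ioc a b)) : Measurable μ := by
  rcases isEmpty_or_nonempty α with hα | hα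
  · have : μ = fun _ => 0 := funext fun _ => Subsingleton.elim _ _
    rw [this]
    exact measurable_const
  obtain ⟨u, v, hmono, huv⟩ := exists_monotone_Ioc_exhaustion α
  have hrestr (n : ℕ) : Measurable fun ω => (μ ω).restrict (Set.Ioc (u n) (v n)) := by
    have hf (ω : Ω) : IsFiniteMeasure ((μ ω).restrict (Set.Ioc (u n) (v n))) :=
      ⟨by simpa using (hfin ω (u n) (v n)).lt_top⟩
    refine Measurable.measure_of_isPiSystem
      (BorelSpace.measurable_eq.trans (borel_eq_generateFrom_Iic α)) isPiSystem_Iic ?_ ?_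
    · rintro _ ⟨a, rfl⟩
      simp_rw [Measure.restrict_apply measurableSet_Iic, Set.inter_comm (Set.Iic a),
        Set.Ioc_inter_Iic]
      exact h _ _
    · simpa using h _ _
  refine Measure.measurable_of_measurable_coe _ fun s hs => ?_
  -- The part of `s` outside the exhaustion lies in the null set `botSet`, so monotone continuity
  -- recovers the full mass of `s`.
  have hsup (ω : Ω) : μ ω s = ⨆ n, (μ ω).restrict (Set.Ioc (u n) (v n)) s := by
    simp_rw [Measure.restrict_apply hs]
    rw [← Monotone.measure_iUnion fun m n hmn => Set.inter_subset_inter_right s (hmono hmn),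
      ← Set.inter_iUnion]
    refine (measure_inter_conull ?_).symm
    exact measure_mono_null huv (hbot ω)
  simp_rw [hsup]
  exact .iSup fun n => (Measure.measurable_coe hs).comp (hrestr n)

end HalfOpenIntervals

/-! ### First two moments of the Poisson distribution -/

section Poisson

open scoped NNReal Nat

/-- The size-bias identity `E[N f(N - 1)] = r E[f(N)]` of the Poisson distribution. -/
lemma hasSum_poisson_mul_nat (r : ℝ≥0) {f : ℕ → ℝ} {c : ℝ}
    (h : HasSum (fun n => Real.exp (-r) * r ^ n / n ! * f n) c) :
    HasSum (fun n => Real.exp (-r) * r ^ n / n ! * (n * f (n - 1))) (r * c) := by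
  -- The term at `0` vanishes; after the shift, the factor `n + 1` cancels against `(n + 1)!`.
  rw [← hasSum_nat_add_iff' 1]
  simp only [Finset.range_one, Finset.sum_singleton, Nat.cast_zero, zero_mul, mul_zero, sub_zero,
    Nat.add_sub_cancel]
  convert! h.mul_left (r : ℝ) using 2 with n
  rw [Nat.factorial_succ]
  push_cast
  have : (n ! : ℝ) ≠ 0 := by positivity
  field_simp
  ring

lemma hasSum_poisson_id (r : ℝ≥0) :
    HasSum (fun n : ℕ => Real.exp (-r) * r ^ n / n ! * n) r := by
  simpa using hasSum_poisson_mul_nat r (f := fun _ => 1) (c := 1)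
    (by simpa using hasSum_one_poissonMeasure r)

lemma hasSum_poisson_sq (r : ℝ≥0) :
    HasSum (fun n : ℕ => Real.exp (-r) * r ^ n / n ! * (n : ℝ) ^ 2) (r + r ^ 2) := by
  -- With this `f`, `n * f (n - 1) = n ^ 2`; at `n = 0` the outer factor hides the truncated
  -- subtraction.
  have h := hasSum_poisson_mul_nat r (f := fun n => n + 1) (c := r + 1)
    (by simpa [mul_add] using (hasSum_poisson_id r).add (hasSum_one_poissonMeasure r))
  convert! h using 1
  · ext (_ | n) <;> simp [sq]
  · ring

lemma memLp_two_id_poisson (r : ℝ≥0) :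
    MemLp id 2 ((poissonMeasure r).map ((↑) : ℕ → ℝ)) := by
  rw [memLp_two_iff_integrable_sq (by fun_prop),
    integrable_map_measure (by fun_prop) .of_discrete, integrable_poissonMeasure_iff]
  simpa using (hasSum_poisson_sq r).summable

lemma integral_id_poisson (r : ℝ≥0) :
    ∫ x, x ∂((poissonMeasure r).map ((↑) : ℕ → ℝ)) = r := by
  rw [integral_map .of_discrete (by fun_prop), integral_poissonMeasure]
  simpa using (hasSum_poisson_id r).tsum_eq

lemma integral_sq_poisson (r : ℝ≥0) :
    ∫ x, x ^ 2 ∂((poissonMeasure r).map ((↑) : ℕ → ℝ)) = r + r ^ 2 := by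
  rw [integral_map .of_discrete (by fun_prop), integral_poissonMeasure]
  simpa using (hasSum_poisson_sq r).tsum_eq

end Poisson

/-! ### Measurability of integrals against a random measure -/

section RandomIntegral

/-- The integral of a fixed measurable function against a random measure is measurable. -/
lemma measurable_integral_random_measure {α Ω : Type*} [MeasurableSpace α] [MeasurableSpace Ω]
    {d : ℕ} {μ : Ω → Measure α} (hμ : Measurable μ) {g : α → EuclideanSpace ℝ (Fin d)}
    (hg : Measurable g) : Measurable fun ω => ∫ x, g x ∂(μ ω) := by
  have hint : MeasurableSet {ω | ∫⁻ x, ‖g x‖ₑ ∂(μ ω) < ⊤} :=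
    measurableSet_lt ((Measure.measurable_lintegral hg.enorm).comp hμ) measurable_const
  have hgi (i : Fin d) : Measurable fun x => g x i := by fun_prop
  -- The Bochner integral is `0` by default where `g` is not integrable, hence the indicator of the
  -- integrability event.
  have key : (fun ω => ∫ x, g x ∂(μ ω)) = fun ω => WithLp.toLp 2 fun i =>
      {ω | ∫⁻ x, ‖g x‖ₑ ∂(μ ω) < ⊤}.indicator
        (fun ω => (∫⁻ x, ENNReal.ofReal (g x i) ∂(μ ω)).toReal -
          (∫⁻ x, ENNReal.ofReal (-g x i) ∂(μ ω)).toReal) ω := by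
    ext ω i
    by_cases h : Integrable g (μ ω)
    · have hω : ω ∈ {ω | ∫⁻ x, ‖g x‖ₑ ∂(μ ω) < ⊤} := h.2
      rw [eval_integral_piLp fun i => h.eval_piLp i]
      simp only [Set.indicator_of_mem hω]
      exact integral_eq_lintegral_pos_part_sub_lintegral_neg_part (h.eval_piLp i)
    · have hω : ω ∉ {ω | ∫⁻ x, ‖g x‖ₑ ∂(μ ω) < ⊤} :=
        fun hω => h ⟨hg.aestronglyMeasurable, hω⟩
      simp only [Set.indicator_of_notMem hω, integral_undef h]
      rfl
  rw [key]
  refine (WithLp.measurable_toLp 2 _).comp (measurable_pi_lambda _ fun i => ?_)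
  refine Measurable.indicator ?_ hint
  exact (((Measure.measurable_lintegral (hgi i).ennreal_ofReal).comp hμ).ennreal_toReal).sub
    (((Measure.measurable_lintegral (hgi i).neg.ennreal_ofReal).comp hμ).ennreal_toReal)

end RandomIntegral

/-! ### The Stieltjes integral as a function of the path -/

section CountingPath

variable {T : Set ℝ} [T.OrdConnected]

/-- The random counting measure of a counting process is measurable with respect to any
`σ`-algebra that makes the increments measurable. -/
lemma measurable_countingMeasure {Ω : Type*} [MeasurableSpace Ω] {X : Ω → CountingPath T}
    (hX : ∀ s t, Measurable fun ω => (X ω).toFun t - (X ω).toFun s) :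
    Measurable fun ω => (X ω).toStieltjesFunction.measure := by
  refine measurable_measure_of_Ioc (fun ω => StieltjesFunction.measure_botSet _)
    (fun ω a b => by simp) fun a b => ?_
  simp only [StieltjesFunction.measure_Ioc]
  exact (hX a b).ennreal_ofReal

/-- The Stieltjes integral along a counting path is a measurable function of the path, recentred at
an arbitrary base point. -/
lemma CountingPath.exists_measurable_integral_eq {d : ℕ} {g : ℝ → EuclideanSpace ℝ (Fin d)}
    (hg : Measurable g) (t₀ : T) :
    ∃ φ : (T → ℝ) → EuclideanSpace ℝ (Fin d), Measurable φ ∧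
      ∀ x : CountingPath T, x.integral g = φ fun t => x.toFun t - x.toFun t₀ := by
  let inc : CountingPath T → T → ℝ := fun x t => x.toFun t - x.toFun t₀
  -- With the coarsest σ-algebra that makes `inc` measurable, a measurable function of the path must
  -- factor through `inc` (Doob–Dynkin).
  let _ : MeasurableSpace (CountingPath T) := MeasurableSpace.comap inc inferInstance
  have hinc : Measurable inc := comap_measurable inc
  have hN : Measurable fun x : CountingPath T => x.toStieltjesFunction.measure := by
    refine measurable_countingMeasure (X := fun x => x) fun s t => ?_
    have : (fun x : CountingPath T => x.toFun t - x.toFun s) = fun x => inc x t - inc x s := by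
      ext x
      simp [inc]
    rw [this]
    exact ((measurable_pi_apply t).comp hinc).sub ((measurable_pi_apply s).comp hinc)
  have hm : Measurable fun x : CountingPath T => x.integral g :=
    measurable_integral_random_measure hN (hg.comp measurable_subtype_coe)
  obtain ⟨φ, hφ, h⟩ := hm.exists_eq_measurable_comp
  exact ⟨φ, hφ, fun x => congrFun h x⟩

end CountingPath

/-! ### Laws of processes with independent increments -/

section FiniteDimensionalLaws

/-- Independence of increments is applied along a monotone sequence indexed by `ℕ`; the increasing
enumeration of `s` is continued by its maximum. -/
lemma Finset.exists_monotone_nat_subset_range {α : Type*} [LinearOrder α] (s : Finset α)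
    (hs : s.Nonempty) : ∃ τ : ℕ → α, Monotone τ ∧ ∀ x ∈ s, ∃ n, τ n = x := by
  have hcard : 0 < s.card := hs.card_pos
  refine ⟨fun n => s.orderEmbOfFin rfl ⟨min n (s.card - 1), by omega⟩, fun m n h => ?_,
    fun x hx => ?_⟩
  · refine (s.orderEmbOfFin rfl).monotone ?_
    simp only [Fin.mk_le_mk]
    omega
  · obtain ⟨i, hi⟩ : x ∈ Set.range (s.orderEmbOfFin rfl) := by simpa using hx
    refine ⟨i, ?_⟩
    rw [← hi]
    exact congrArg (s.orderEmbOfFin rfl) (Fin.ext (min_eq_left (Nat.le_sub_one_of_lt i.2)))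

/-- The law of a process with independent increments, recentred at a base point, is determined by
the laws of its increments. -/
lemma ProbabilityTheory.HasIndepIncrements.map_sub_eq {T Ω : Type*} [LinearOrder T]
    [MeasurableSpace Ω] {P : Measure Ω} [IsProbabilityMeasure P] {X Y : T → Ω → ℝ}
    (hX : ∀ t, Measurable (X t)) (hY : ∀ t, Measurable (Y t))
    (hXi : HasIndepIncrements X P) (hYi : HasIndepIncrements Y P)
    (h : ∀ s t, s ≤ t →
      P.map (fun ω => X t ω - X s ω) = P.map (fun ω => Y t ω - Y s ω)) (t₀ : T) :
    P.map (fun ω t => X t ω - X t₀ ω) = P.map (fun ω t => Y t ω - Y t₀ ω) := by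
  have mX : Measurable fun ω t => X t ω - X t₀ ω :=
    measurable_pi_lambda _ fun t => (hX t).sub (hX t₀)
  have mY : Measurable fun ω t => Y t ω - Y t₀ ω :=
    measurable_pi_lambda _ fun t => (hY t).sub (hY t₀)
  refine (map_eq_iff_forall_finset_map_restrict_eq (X := fun t ω => X t ω - X t₀ ω)
    (Y := fun t ω => Y t ω - Y t₀ ω) mX.aemeasurable mY.aemeasurable).2 fun I => ?_
  obtain ⟨τ, hτ, hrange⟩ :=
    (insert t₀ I).exists_monotone_nat_subset_range (Finset.insert_nonempty _ _)
  obtain ⟨q, hq⟩ := hrange t₀ (Finset.mem_insert_self _ _)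
  choose p hp using fun t : I => hrange t (Finset.mem_insert_of_mem t.2)
  -- Partial sums of consecutive increments telescope to values relative to `τ 0`; subtracting the
  -- sum up to `q`, where `τ q = t₀`, moves the base point to `t₀`.
  let ψ : (ℕ → ℝ) → I → ℝ := fun x t =>
    ∑ i ∈ Finset.range (p t), x i - ∑ i ∈ Finset.range q, x i
  have hψ : Measurable ψ := by fun_prop
  have key (Z : T → Ω → ℝ) (hZ : ∀ t, Measurable (Z t)) :
      P.map (fun ω => I.restrict fun t => Z t ω - Z t₀ ω) =
        (P.map fun ω i => Z (τ (i + 1)) ω - Z (τ i) ω).map ψ := by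
    rw [Measure.map_map hψ (by fun_prop)]
    congr 1
    ext ω t
    simp only [Function.comp_apply, ψ, Finset.restrict]
    rw [Finset.sum_range_sub (fun i => Z (τ i) ω), Finset.sum_range_sub (fun i => Z (τ i) ω),
      hp t, hq]
    ring
  rw [key X hX, key Y hY,
    (iIndepFun_iff_map_fun_eq_infinitePi_map (by fun_prop)).1 (hXi.nat hτ),
    (iIndepFun_iff_map_fun_eq_infinitePi_map (by fun_prop)).1 (hYi.nat hτ)]
  congr 2
  ext1 i
  exact h _ _ (hτ i.le_succ)

end FiniteDimensionalLaws

/-! ### The integrals are independent and identically distributed -/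

section IndependentIntegrals

variable {T : Set ℝ} [T.OrdConnected] {Ω : Type*} [MeasurableSpace Ω] {P : Measure Ω}
  {d : ℕ} {g : ℝ → EuclideanSpace ℝ (Fin d)} {lam : ℝ → ℝ}

lemma IsPoissonProcess.measurable_countingMeasure {X : Ω → CountingPath T}
    (hX : IsPoissonProcess X lam P) : Measurable fun ω => (X ω).toStieltjesFunction.measure :=
  _root_.measurable_countingMeasure fun s t => (hX.measurable t).sub (hX.measurable s)

lemma IsPoissonProcess.measurable_integral {X : Ω → CountingPath T}
    (hX : IsPoissonProcess X lam P) (hg : Measurable g) :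
    Measurable fun ω => (X ω).integral g :=
  measurable_integral_random_measure hX.measurable_countingMeasure
    (hg.comp measurable_subtype_coe)

/-- The integral depends only on the recentred path, whose law the increments fix. The law of an
unrecentred value is not fixed when `T` has no least element. -/
lemma IsPoissonProcess.identDistrib_integral [IsProbabilityMeasure P] {X Y : Ω → CountingPath T}
    (hX : IsPoissonProcess X lam P) (hY : IsPoissonProcess Y lam P) (hg : Measurable g) :
    IdentDistrib (fun ω => (X ω).integral g) (fun ω => (Y ω).integral g) P P := by
  refine ⟨(hX.measurable_integral hg).aemeasurable, (hY.measurable_integral hg).aemeasurable, ?_⟩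
  rcases isEmpty_or_nonempty T with hT | ⟨⟨t₀⟩⟩
  · simp [CountingPath.integral, Measure.eq_zero_of_isEmpty]
  obtain ⟨φ, hφ, h⟩ := CountingPath.exists_measurable_integral_eq hg t₀
  have hmap {Z : Ω → CountingPath T} (hZ : IsPoissonProcess Z lam P) :
      P.map (fun ω => (Z ω).integral g) =
        (P.map fun ω t => (Z ω).toFun t - (Z ω).toFun t₀).map φ := by
    have hm := hZ.measurable
    rw [Measure.map_map hφ (by fun_prop)]
    congr 1
    ext1 ω
    exact h _
  rw [hmap hX, hmap hY, HasIndepIncrements.map_sub_eq hX.measurable hY.measurable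
    hX.indep_increments hY.indep_increments (fun s t hst => ?_) t₀]
  rw [(hX.law_increments s t hst).map_eq, (hY.law_increments s t hst).map_eq]

lemma iIndepFun_countingPath_integral {X : ℕ → Ω → CountingPath T} (hg : Measurable g)
    (hindep : iIndepFun (fun j ω (t : T) => (X j ω).toFun t) P) :
    iIndepFun (fun j ω => (X j ω).integral g) P := by
  rcases isEmpty_or_nonempty T with hT | ⟨⟨t₀⟩⟩
  · have h : (fun j ω => (X j ω).integral g) =
        fun j => (fun _ => 0) ∘ fun ω (t : T) => (X j ω).toFun t := by
      ext1 j
      ext1 ω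
      simp [CountingPath.integral, Measure.eq_zero_of_isEmpty]
    rw [h]
    exact hindep.comp (fun _ _ => 0) fun _ => measurable_const
  obtain ⟨φ, hφ, h⟩ := CountingPath.exists_measurable_integral_eq hg t₀
  have h' : (fun j ω => (X j ω).integral g) =
      fun j => (fun x : T → ℝ => φ fun t => x t - x t₀) ∘ fun ω (t : T) => (X j ω).toFun t := by
    ext1 j
    ext1 ω
    exact h _
  rw [h']
  exact hindep.comp (fun _ x => φ fun t => x t - x t₀) fun _ => hφ.comp (by fun_prop)

end IndependentIntegrals

/-! ### The intensity measure -/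

section Intensity

variable {T : Set ℝ} {lam : ℝ → ℝ}

/-- The intensity measure `lam(s) ds` on `T`. -/
noncomputable def intensityMeasure (T : Set ℝ) (lam : ℝ → ℝ) : Measure T :=
  ((volume.restrict T).withDensity fun s => ENNReal.ofReal (lam s)).comap (↑)

lemma IsIntensity.aemeasurable_ofReal (h : IsIntensity T lam) :
    AEMeasurable (fun s => ENNReal.ofReal (lam s)) (volume.restrict T) :=
  h.locallyIntegrableOn.aestronglyMeasurable.aemeasurable.ennreal_ofReal

variable [T.OrdConnected]

lemma measurableSet_of_ordConnected (T : Set ℝ) [hT : T.OrdConnected] : MeasurableSet T :=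
  hT.measurableSet

lemma intensityMeasure_botSet : intensityMeasure T lam botSet = 0 := by
  rw [intensityMeasure,
    (MeasurableEmbedding.subtype_coe (measurableSet_of_ordConnected T)).comap_apply]
  refine ((withDensity_absolutelyContinuous _ _).trans Measure.restrict_le_self.absolutelyContinuous)
    ?_
  exact (subsingleton_botSet.image _).measure_zero _

lemma IsIntensity.intervalIntegrable (h : IsIntensity T lam) (s t : T) :
    IntervalIntegrable lam volume s t := by
  rw [intervalIntegrable_iff']
  exact h.locallyIntegrableOn.integrableOn_compact_subset
    (‹T.OrdConnected›.uIcc_subset s.2 t.2) isCompact_uIcc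

lemma IsIntensity.integral_nonneg (h : IsIntensity T lam) {s t : T} (hst : s ≤ t) :
    0 ≤ ∫ u in (s : ℝ)..t, lam u :=
  intervalIntegral.integral_nonneg hst fun _ hu =>
    h.nonneg _ (‹T.OrdConnected›.out s.2 t.2 hu)

lemma IsIntensity.intensityMeasure_Ioc (h : IsIntensity T lam) {s t : T} (hst : s ≤ t) :
    intensityMeasure T lam (Set.Ioc s t) = ENNReal.ofReal (∫ u in (s : ℝ)..t, lam u) := by
  have himage : ((↑) : T → ℝ) '' Set.Ioc s t = Set.Ioc (s : ℝ) t := by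
    ext x
    constructor
    · rintro ⟨y, hy, rfl⟩
      exact ⟨hy.1, hy.2⟩
    · intro hx
      exact ⟨⟨x, ‹T.OrdConnected›.out s.2 t.2 ⟨hx.1.le, hx.2⟩⟩, ⟨hx.1, hx.2⟩, rfl⟩
  have hsub : Set.Ioc (s : ℝ) t ⊆ T := fun x hx =>
    ‹T.OrdConnected›.out s.2 t.2 ⟨hx.1.le, hx.2⟩
  rw [intensityMeasure,
    (MeasurableEmbedding.subtype_coe (measurableSet_of_ordConnected T)).comap_apply, himage,
    withDensity_apply _ measurableSet_Ioc, Measure.restrict_restrict measurableSet_Ioc,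
    Set.inter_eq_left.2 hsub, intervalIntegral.integral_of_le hst,
    ofReal_integral_eq_lintegral_ofReal
      ((intervalIntegrable_iff_integrableOn_Ioc_of_le hst).1 (h.intervalIntegrable s t))]
  exact (ae_restrict_iff' measurableSet_Ioc).2 (ae_of_all _ fun x hx => h.nonneg x (hsub hx))

lemma IsIntensity.intensityMeasure_Ioc_ne_top (h : IsIntensity T lam) (s t : T) :
    intensityMeasure T lam (Set.Ioc s t) ≠ ⊤ := by
  rcases le_total s t with hst | hst
  · rw [h.intensityMeasure_Ioc hst]
    exact ENNReal.ofReal_ne_top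
  · simp [Set.Ioc_eq_empty hst.not_gt]

lemma IsIntensity.integral_intensityMeasure {E : Type*} [NormedAddCommGroup E] [NormedSpace ℝ E]
    (h : IsIntensity T lam) (f : ℝ → E) :
    ∫ s : T, f s ∂(intensityMeasure T lam) = ∫ s in T, lam s • f s := by
  have hT := measurableSet_of_ordConnected T
  rw [intensityMeasure, integral_subtype_comap hT, restrict_withDensity hT,
    Measure.restrict_restrict hT, Set.inter_self,
    integral_withDensity_eq_integral_toReal_smul₀ h.aemeasurable_ofReal (by simp)]
  refine setIntegral_congr_fun hT fun s hs => ?_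
  simp [ENNReal.toReal_ofReal (h.nonneg s hs)]

lemma IsIntensity.integrable_intensityMeasure_iff {E : Type*} [NormedAddCommGroup E]
    [NormedSpace ℝ E] (h : IsIntensity T lam) (f : ℝ → E) :
    Integrable (fun s : T => f s) (intensityMeasure T lam) ↔
      IntegrableOn (fun s => lam s • f s) T := by
  have hT := measurableSet_of_ordConnected T
  rw [intensityMeasure, ← Function.comp_def f, ← (MeasurableEmbedding.subtype_coe hT).integrable_map_iff,
    map_comap_subtype_coe hT, restrict_withDensity hT, Measure.restrict_restrict hT, Set.inter_self,
    integrable_withDensity_iff_integrable_smul₀' h.aemeasurable_ofReal (by simp), ← IntegrableOn]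
  refine integrableOn_congr_fun (fun s hs => ?_) hT
  simp [ENNReal.toReal_ofReal (h.nonneg s hs)]

end Intensity

/-! ### Second moments of interval counts -/

section SecondMoments

variable {T : Set ℝ} {Ω : Type*} [MeasurableSpace Ω] {P : Measure Ω}
  {lam : ℝ → ℝ} {X : Ω → CountingPath T}

lemma IsPoissonProcess.memLp_increment (hX : IsPoissonProcess X lam P) {s t : T} (hst : s ≤ t) :
    MemLp (fun ω => (X ω).toFun t - (X ω).toFun s) 2 P := by
  have h := hX.law_increments s t hst
  have hid := memLp_two_id_poisson (∫ u in (s : ℝ)..t, lam u).toNNReal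
  rw [← h.map_eq] at hid
  exact (memLp_map_measure_iff (by fun_prop) h.aemeasurable).1 hid

variable [T.OrdConnected]

lemma IsPoissonProcess.integral_increment (hlam : IsIntensity T lam)
    (hX : IsPoissonProcess X lam P) {s t : T} (hst : s ≤ t) :
    ∫ ω, ((X ω).toFun t - (X ω).toFun s) ∂P = ∫ u in (s : ℝ)..t, lam u := by
  rw [(hX.law_increments s t hst).integral_eq, integral_id_poisson,
    Real.coe_toNNReal _ (hlam.integral_nonneg hst)]

lemma IsPoissonProcess.integral_increment_sq (hlam : IsIntensity T lam)
    (hX : IsPoissonProcess X lam P) {s t : T} (hst : s ≤ t) :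
    ∫ ω, ((X ω).toFun t - (X ω).toFun s) ^ 2 ∂P =
      (∫ u in (s : ℝ)..t, lam u) + (∫ u in (s : ℝ)..t, lam u) ^ 2 := by
  have h := (hX.law_increments s t hst).integral_comp (f := fun x => x ^ 2) (by fun_prop)
  rw [integral_sq_poisson, Real.coe_toNNReal _ (hlam.integral_nonneg hst)] at h
  exact h

/-- Splitting the longer increment at `s` leaves the square of a Poisson variable plus a product of
independent increments. -/
lemma IsPoissonProcess.integral_increment_mul_of_le (hlam : IsIntensity T lam)
    (hX : IsPoissonProcess X lam P) {r s t : T} (hrs : r ≤ s) (hst : s ≤ t) :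
    ∫ ω, ((X ω).toFun s - (X ω).toFun r) * ((X ω).toFun t - (X ω).toFun r) ∂P =
      (∫ u in (r : ℝ)..s, lam u) +
        (∫ u in (r : ℝ)..s, lam u) * ∫ u in (r : ℝ)..t, lam u := by
  have hind := hX.indep_increments.indepFun_sub_sub hrs hst
  have hmul : ∫ ω, ((X ω).toFun s - (X ω).toFun r) * ((X ω).toFun t - (X ω).toFun s) ∂P =
      (∫ u in (r : ℝ)..s, lam u) * ∫ u in (s : ℝ)..t, lam u := by
    rw [← hX.integral_increment hlam hrs, ← hX.integral_increment hlam hst]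
    exact hind.integral_mul_eq_mul_integral (hX.memLp_increment hrs).aestronglyMeasurable
      (hX.memLp_increment hst).aestronglyMeasurable
  have hsplit : (fun ω => ((X ω).toFun s - (X ω).toFun r) * ((X ω).toFun t - (X ω).toFun r)) =
      fun ω => ((X ω).toFun s - (X ω).toFun r) ^ 2 +
        ((X ω).toFun s - (X ω).toFun r) * ((X ω).toFun t - (X ω).toFun s) := by
    ext ω
    ring
  have hint : Integrable
      (fun ω => ((X ω).toFun s - (X ω).toFun r) * ((X ω).toFun t - (X ω).toFun s)) P :=
    (hX.memLp_increment hrs).integrable_mul (hX.memLp_increment hst)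
  rw [hsplit, integral_add (hX.memLp_increment hrs).integrable_sq hint, hmul,
    hX.integral_increment_sq hlam hrs, ← intervalIntegral.integral_add_adjacent_intervals
      (hlam.intervalIntegrable r s) (hlam.intervalIntegrable s t)]
  ring

lemma IsPoissonProcess.integral_increment_mul (hlam : IsIntensity T lam)
    (hX : IsPoissonProcess X lam P) {r s t : T} (hrs : r ≤ s) (hrt : r ≤ t) :
    ∫ ω, ((X ω).toFun s - (X ω).toFun r) * ((X ω).toFun t - (X ω).toFun r) ∂P =
      (∫ u in (r : ℝ)..(s ⊓ t : T), lam u) +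
        (∫ u in (r : ℝ)..s, lam u) * ∫ u in (r : ℝ)..t, lam u := by
  rcases le_total s t with hst | hst
  · rw [hX.integral_increment_mul_of_le hlam hrs hst, inf_eq_left.2 hst]
  · simp_rw [mul_comm ((X _).toFun s - (X _).toFun r)]
    rw [hX.integral_increment_mul_of_le hlam hrt hst, inf_eq_right.2 hst, mul_comm]

/-- The mixed second moment of the numbers of points in two half-open intervals. -/
lemma IsPoissonProcess.lintegral_measure_Ioc_mul (hlam : IsIntensity T lam)
    (hX : IsPoissonProcess X lam P) {a b c d : T} (hab : a ≤ b) (hcd : c ≤ d) :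
    ∫⁻ ω, (X ω).toStieltjesFunction.measure (Set.Ioc a b) *
        (X ω).toStieltjesFunction.measure (Set.Ioc c d) ∂P =
      intensityMeasure T lam (Set.Ioc a b) * intensityMeasure T lam (Set.Ioc c d) +
        intensityMeasure T lam (Set.Ioc a b ∩ Set.Ioc c d) := by
  -- From a base point below both intervals, every count is a difference of values `D t`, whose
  -- covariances are `m (s ⊓ t)`.
  obtain ⟨r, hra, hrc⟩ : ∃ r : T, r ≤ a ∧ r ≤ c := ⟨a ⊓ c, inf_le_left, inf_le_right⟩
  have hrb := hra.trans hab
  have hrd := hrc.trans hcd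
  let D : T → Ω → ℝ := fun t ω => (X ω).toFun t - (X ω).toFun r
  let m : T → ℝ := fun t => ∫ u in (r : ℝ)..t, lam u
  have hm (s t : T) : ∫ u in (s : ℝ)..t, lam u = m t - m s :=
    (intervalIntegral.integral_interval_sub_left (hlam.intervalIntegrable r t)
      (hlam.intervalIntegrable r s)).symm
  have hmono : Monotone m := fun s t hst => by
    have := hlam.integral_nonneg hst
    rw [hm] at this
    linarith
  have hD {t : T} (ht : r ≤ t) : MemLp (D t) 2 P := hX.memLp_increment ht
  have hDD {s t : T} (hs : r ≤ s) (ht : r ≤ t) :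
      ∫ ω, D s ω * D t ω ∂P = m (s ⊓ t) + m s * m t := hX.integral_increment_mul hlam hs ht
  have hDi {s t : T} (hs : r ≤ s) (ht : r ≤ t) : Integrable (fun ω => D s ω * D t ω) P :=
    (hD hs).integrable_mul (hD ht)
  have hDs {q s t : T} (hq : r ≤ q) (hs : r ≤ s) (ht : r ≤ t) :
      Integrable (fun ω => D q ω * D s ω - D q ω * D t ω) P := (hDi hq hs).sub (hDi hq ht)
  have hsplit : (fun ω => ((X ω).toFun b - (X ω).toFun a) * ((X ω).toFun d - (X ω).toFun c)) =
      fun ω => (D b ω * D d ω - D b ω * D c ω) - (D a ω * D d ω - D a ω * D c ω) := by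
    ext ω
    simp only [D]
    ring
  have hint : Integrable
      (fun ω => ((X ω).toFun b - (X ω).toFun a) * ((X ω).toFun d - (X ω).toFun c)) P :=
    (hX.memLp_increment hab).integrable_mul (hX.memLp_increment hcd)
  have hreal : ∫ ω, ((X ω).toFun b - (X ω).toFun a) * ((X ω).toFun d - (X ω).toFun c) ∂P =
      (m b - m a) * (m d - m c) + (m (b ⊓ d) - m (b ⊓ c) - (m (a ⊓ d) - m (a ⊓ c))) := by
    rw [hsplit, integral_sub (hDs hrb hrd hrc) (hDs hra hrd hrc),
      integral_sub (hDi hrb hrd) (hDi hrb hrc), integral_sub (hDi hra hrd) (hDi hra hrc),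
      hDD hrb hrd, hDD hrb hrc, hDD hra hrd, hDD hra hrc]
    ring
  -- The mixed difference of `m (· ⊓ ·)` over the rectangle is the intensity of the overlap, and `0`
  -- when the intervals are disjoint.
  obtain ⟨hnn, hinter⟩ : 0 ≤ m (b ⊓ d) - m (b ⊓ c) - (m (a ⊓ d) - m (a ⊓ c)) ∧
      intensityMeasure T lam (Set.Ioc a b ∩ Set.Ioc c d) =
        ENNReal.ofReal (m (b ⊓ d) - m (b ⊓ c) - (m (a ⊓ d) - m (a ⊓ c))) := by
    rw [Set.Ioc_inter_Ioc]
    rcases le_total (a ⊔ c) (b ⊓ d) with hle | hle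
    · have hbc : c ≤ b := (le_sup_right.trans hle).trans inf_le_left
      have had : a ≤ d := (le_sup_left.trans hle).trans inf_le_right
      have hκ : m (b ⊓ d) - m (b ⊓ c) - (m (a ⊓ d) - m (a ⊓ c)) = m (b ⊓ d) - m (a ⊔ c) := by
        rw [inf_eq_right.2 hbc, inf_eq_left.2 had]
        rcases le_total a c with hac | hac
        · rw [sup_eq_right.2 hac, inf_eq_left.2 hac]
          ring
        · rw [sup_eq_left.2 hac, inf_eq_right.2 hac]
          ring
      rw [hκ, hlam.intensityMeasure_Ioc hle, hm]
      exact ⟨sub_nonneg.2 (hmono hle), rfl⟩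
    · have hκ : m (b ⊓ d) - m (b ⊓ c) - (m (a ⊓ d) - m (a ⊓ c)) = 0 := by
        rcases inf_le_iff.1 hle with hb | hd
        · rcases le_sup_iff.1 hb with h | h
          · simp [le_antisymm h hab]
          · rw [inf_eq_left.2 (h.trans hcd), inf_eq_left.2 h,
              inf_eq_left.2 (hab.trans (h.trans hcd)), inf_eq_left.2 (hab.trans h)]
            simp
        · rcases le_sup_iff.1 hd with h | h
          · rw [inf_eq_right.2 (h.trans hab), inf_eq_right.2 ((hcd.trans h).trans hab),
              inf_eq_right.2 h, inf_eq_right.2 (hcd.trans h)]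
            simp
          · simp [le_antisymm h hcd]
      rw [hκ, Set.Ioc_eq_empty hle.not_gt]
      simp
  simp_rw [StieltjesFunction.measure_Ioc]
  rw [hinter, hlam.intensityMeasure_Ioc hab, hlam.intensityMeasure_Ioc hcd, hm, hm,
    ← ENNReal.ofReal_mul (sub_nonneg.2 (hmono hab)), ← ENNReal.ofReal_add
      (mul_nonneg (sub_nonneg.2 (hmono hab)) (sub_nonneg.2 (hmono hcd))) hnn, ← hreal,
    ofReal_integral_eq_lintegral_ofReal hint (ae_of_all _ fun ω => mul_nonneg
      (sub_nonneg.2 ((X ω).mono hab)) (sub_nonneg.2 ((X ω).mono hcd)))]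
  refine lintegral_congr fun ω => ?_
  rw [ENNReal.ofReal_mul (sub_nonneg.2 ((X ω).mono hab))]

end SecondMoments

/-! ### Campbell's formulas -/

section Campbell

variable {T : Set ℝ} [T.OrdConnected] {Ω : Type*} [MeasurableSpace Ω] {P : Measure Ω}
  {lam : ℝ → ℝ} {X : Ω → CountingPath T}

lemma IsPoissonProcess.measurable_lintegral (hX : IsPoissonProcess X lam P) {f : T → ENNReal}
    (hf : Measurable f) :
    Measurable fun ω => ∫⁻ s, f s ∂(X ω).toStieltjesFunction.measure :=
  (Measure.measurable_lintegral hf).comp hX.measurable_countingMeasure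

lemma IsPoissonProcess.bind_botSet (hX : IsPoissonProcess X lam P) {Q : Measure Ω} :
    Q.bind (fun ω => (X ω).toStieltjesFunction.measure) botSet = 0 := by
  rw [Measure.bind_apply measurableSet_botSet hX.measurable_countingMeasure.aemeasurable]
  simp

/-- **Campbell's formula** for the mean measure of a Poisson process. -/
lemma IsPoissonProcess.bind_countingMeasure (hlam : IsIntensity T lam)
    (hX : IsPoissonProcess X lam P) :
    P.bind (fun ω => (X ω).toStieltjesFunction.measure) = intensityMeasure T lam := by
  refine (Measure.ext_of_Ioc_of_botSet intensityMeasure_botSet hX.bind_botSet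
    hlam.intensityMeasure_Ioc_ne_top fun a b hab => ?_).symm
  have := (hX.law_increments a b hab).isProbabilityMeasure
  rw [Measure.bind_apply measurableSet_Ioc hX.measurable_countingMeasure.aemeasurable,
    hlam.intensityMeasure_Ioc hab, ← hX.integral_increment hlam hab,
    ofReal_integral_eq_lintegral_ofReal ((hX.memLp_increment hab).integrable one_le_two)
      (ae_of_all _ fun ω => sub_nonneg.2 ((X ω).mono hab))]
  simp

lemma IsPoissonProcess.lintegral_lintegral (hlam : IsIntensity T lam)
    (hX : IsPoissonProcess X lam P) {f : T → ENNReal} (hf : Measurable f) :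
    ∫⁻ ω, ∫⁻ s, f s ∂(X ω).toStieltjesFunction.measure ∂P =
      ∫⁻ s, f s ∂(intensityMeasure T lam) := by
  rw [← hX.bind_countingMeasure hlam,
    Measure.lintegral_bind hX.measurable_countingMeasure.aemeasurable hf.aemeasurable]

/-- For a fixed interval both sides are integrals of `f` against a measure: on the left, the mean
measure of the process under `P` weighted by the count of the interval. It suffices to compare these
on intervals. -/
lemma IsPoissonProcess.lintegral_measure_Ioc_mul_lintegral (hlam : IsIntensity T lam)
    (hX : IsPoissonProcess X lam P) {c d : T} (hcd : c ≤ d) {f : T → ENNReal}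
    (hf : Measurable f) :
    ∫⁻ ω, (X ω).toStieltjesFunction.measure (Set.Ioc c d) *
        ∫⁻ s, f s ∂(X ω).toStieltjesFunction.measure ∂P =
      intensityMeasure T lam (Set.Ioc c d) * ∫⁻ s, f s ∂(intensityMeasure T lam) +
        ∫⁻ s in Set.Ioc c d, f s ∂(intensityMeasure T lam) := by
  have hN := hX.measurable_countingMeasure
  have hIoc (a b : T) : Measurable fun ω => (X ω).toStieltjesFunction.measure (Set.Ioc a b) :=
    (Measure.measurable_coe measurableSet_Ioc).comp hN
  have hfin := hlam.intensityMeasure_Ioc_ne_top c d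
  have key : intensityMeasure T lam (Set.Ioc c d) • intensityMeasure T lam +
        (intensityMeasure T lam).restrict (Set.Ioc c d) =
      (P.withDensity fun ω => (X ω).toStieltjesFunction.measure (Set.Ioc c d)).bind
        fun ω => (X ω).toStieltjesFunction.measure := by
    refine Measure.ext_of_Ioc_of_botSet ?_ hX.bind_botSet (fun a b => ?_) fun a b hab => ?_
    · have h0 : (intensityMeasure T lam).restrict (Set.Ioc c d) botSet = 0 :=
        le_antisymm ((Measure.restrict_apply_le _ _).trans_eq intensityMeasure_botSet) bot_le
      simp [intensityMeasure_botSet, h0]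
    · have := hlam.intensityMeasure_Ioc_ne_top a b
      simp only [Measure.add_apply, Measure.smul_apply, smul_eq_mul]
      refine ENNReal.add_ne_top.2 ⟨ENNReal.mul_ne_top hfin this, ?_⟩
      exact ne_top_of_le_ne_top this (Measure.restrict_apply_le _ _)
    · rw [Measure.bind_apply measurableSet_Ioc hN.aemeasurable,
        lintegral_withDensity_eq_lintegral_mul _ (hIoc c d) (hIoc a b)]
      simp only [Pi.mul_apply, Measure.add_apply, Measure.smul_apply, smul_eq_mul,
        Measure.restrict_apply measurableSet_Ioc]
      rw [hX.lintegral_measure_Ioc_mul hlam hcd hab, Set.inter_comm]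
  have h := congrArg (fun μ => ∫⁻ s, f s ∂μ) key
  simp only [lintegral_add_measure, lintegral_smul_measure, smul_eq_mul] at h
  rw [h, Measure.lintegral_bind hN.aemeasurable hf.aemeasurable,
    lintegral_withDensity_eq_lintegral_mul _ (hIoc c d) (hX.measurable_lintegral hf)]
  rfl

/-- **Campbell's formula** for the mixed second moment of two integrals. -/
lemma IsPoissonProcess.lintegral_lintegral_mul_lintegral (hlam : IsIntensity T lam)
    (hX : IsPoissonProcess X lam P) {f h : T → ENNReal} (hf : Measurable f) (hh : Measurable h)
    (hfin : ∫⁻ s, f s ∂(intensityMeasure T lam) ≠ ⊤) :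
    ∫⁻ ω, (∫⁻ s, f s ∂(X ω).toStieltjesFunction.measure) *
        ∫⁻ s, h s ∂(X ω).toStieltjesFunction.measure ∂P =
      (∫⁻ s, f s ∂(intensityMeasure T lam)) * (∫⁻ s, h s ∂(intensityMeasure T lam)) +
        ∫⁻ s, f s * h s ∂(intensityMeasure T lam) := by
  have hN := hX.measurable_countingMeasure
  have hIoc (a b : T) : Measurable fun ω => (X ω).toStieltjesFunction.measure (Set.Ioc a b) :=
    (Measure.measurable_coe measurableSet_Ioc).comp hN
  -- The same comparison with weight `∫ f dX`; finiteness of the intensity integral of `f` keeps the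
  -- masses of intervals finite.
  have key : (∫⁻ s, f s ∂(intensityMeasure T lam)) • intensityMeasure T lam +
        (intensityMeasure T lam).withDensity f =
      (P.withDensity fun ω => ∫⁻ s, f s ∂(X ω).toStieltjesFunction.measure).bind
        fun ω => (X ω).toStieltjesFunction.measure := by
    refine Measure.ext_of_Ioc_of_botSet ?_ hX.bind_botSet (fun a b => ?_) fun a b hab => ?_
    · have h0 := withDensity_absolutelyContinuous (intensityMeasure T lam) f intensityMeasure_botSet
      simp [intensityMeasure_botSet, h0]
    · simp only [Measure.add_apply, Measure.smul_apply, smul_eq_mul,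
        withDensity_apply _ measurableSet_Ioc]
      exact ENNReal.add_ne_top.2 ⟨ENNReal.mul_ne_top hfin (hlam.intensityMeasure_Ioc_ne_top a b),
        ne_top_of_le_ne_top hfin (setLIntegral_le_lintegral _ _)⟩
    · rw [Measure.bind_apply measurableSet_Ioc hN.aemeasurable,
        lintegral_withDensity_eq_lintegral_mul _ (hX.measurable_lintegral hf) (hIoc a b)]
      simp only [Pi.mul_apply, Measure.add_apply, Measure.smul_apply, smul_eq_mul,
        withDensity_apply _ measurableSet_Ioc]
      simp_rw [mul_comm (∫⁻ s, f s ∂(X _).toStieltjesFunction.measure)]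
      rw [hX.lintegral_measure_Ioc_mul_lintegral hlam hab hf, mul_comm]
  have h' := congrArg (fun μ => ∫⁻ s, h s ∂μ) key
  simp only [lintegral_add_measure, lintegral_smul_measure, smul_eq_mul] at h'
  rw [lintegral_withDensity_eq_lintegral_mul _ hf hh] at h'
  simp only [Pi.mul_apply] at h'
  rw [h', Measure.lintegral_bind hN.aemeasurable hh.aemeasurable,
    lintegral_withDensity_eq_lintegral_mul _ (hX.measurable_lintegral hf)
      (hX.measurable_lintegral hh)]
  rfl

lemma IsPoissonProcess.ae_lintegral_lt_top (hlam : IsIntensity T lam)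
    (hX : IsPoissonProcess X lam P) {f : T → ENNReal} (hf : Measurable f)
    (hfin : ∫⁻ s, f s ∂(intensityMeasure T lam) ≠ ⊤) :
    ∀ᵐ ω ∂P, ∫⁻ s, f s ∂(X ω).toStieltjesFunction.measure < ⊤ :=
  ae_lt_top (hX.measurable_lintegral hf) (by rwa [hX.lintegral_lintegral hlam hf])

lemma IsPoissonProcess.ae_integrable {E : Type*} [NormedAddCommGroup E] [MeasurableSpace E]
    [BorelSpace E] [SecondCountableTopology E] (hlam : IsIntensity T lam)
    (hX : IsPoissonProcess X lam P) {f : T → E} (hf : Measurable f)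
    (hfi : Integrable f (intensityMeasure T lam)) :
    ∀ᵐ ω ∂P, Integrable f (X ω).toStieltjesFunction.measure := by
  filter_upwards [hX.ae_lintegral_lt_top hlam hf.enorm hfi.2.ne] with ω hω
  exact ⟨hf.aestronglyMeasurable, hω⟩

lemma IsPoissonProcess.integral_toReal_mul_toReal (hlam : IsIntensity T lam)
    (hX : IsPoissonProcess X lam P) {f h : T → ENNReal} (hf : Measurable f) (hh : Measurable h)
    (hf' : ∫⁻ s, f s ∂(intensityMeasure T lam) ≠ ⊤)
    (hh' : ∫⁻ s, h s ∂(intensityMeasure T lam) ≠ ⊤)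
    (hfh : ∫⁻ s, f s * h s ∂(intensityMeasure T lam) ≠ ⊤) :
    Integrable (fun ω => (∫⁻ s, f s ∂(X ω).toStieltjesFunction.measure).toReal *
        (∫⁻ s, h s ∂(X ω).toStieltjesFunction.measure).toReal) P ∧
    ∫ ω, (∫⁻ s, f s ∂(X ω).toStieltjesFunction.measure).toReal *
        (∫⁻ s, h s ∂(X ω).toStieltjesFunction.measure).toReal ∂P =
      (∫⁻ s, f s ∂(intensityMeasure T lam)).toReal *
        (∫⁻ s, h s ∂(intensityMeasure T lam)).toReal +
          (∫⁻ s, f s * h s ∂(intensityMeasure T lam)).toReal := by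
  have hmeas : Measurable fun ω => (∫⁻ s, f s ∂(X ω).toStieltjesFunction.measure) *
      ∫⁻ s, h s ∂(X ω).toStieltjesFunction.measure :=
    (hX.measurable_lintegral hf).mul (hX.measurable_lintegral hh)
  have hlint := hX.lintegral_lintegral_mul_lintegral hlam hf hh hf'
  have hne : ∫⁻ ω, (∫⁻ s, f s ∂(X ω).toStieltjesFunction.measure) *
        ∫⁻ s, h s ∂(X ω).toStieltjesFunction.measure ∂P ≠ ⊤ := by
    rw [hlint]
    exact ENNReal.add_ne_top.2 ⟨ENNReal.mul_ne_top hf' hh', hfh⟩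
  simp_rw [← ENNReal.toReal_mul]
  refine ⟨integrable_toReal_of_lintegral_ne_top hmeas.aemeasurable hne, ?_⟩
  rw [integral_toReal hmeas.aemeasurable (ae_lt_top hmeas hne), hlint,
    ENNReal.toReal_add (ENNReal.mul_ne_top hf' hh') hfh]

/-- Mean and variance of the integral of a real function against a Poisson process. -/
lemma IsPoissonProcess.memLp_mean_variance_integral [IsProbabilityMeasure P]
    (hlam : IsIntensity T lam) (hX : IsPoissonProcess X lam P) {f : T → ℝ} (hf : Measurable f)
    (hfi : Integrable f (intensityMeasure T lam))
    (hfsq : Integrable (fun s => f s ^ 2) (intensityMeasure T lam)) :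
    MemLp (fun ω => ∫ s, f s ∂(X ω).toStieltjesFunction.measure) 2 P ∧
    ∫ ω, ∫ s, f s ∂(X ω).toStieltjesFunction.measure ∂P =
      ∫ s, f s ∂(intensityMeasure T lam) ∧
    Var[fun ω => ∫ s, f s ∂(X ω).toStieltjesFunction.measure; P] =
      ∫ s, f s ^ 2 ∂(intensityMeasure T lam) := by
  -- The second-moment formula concerns nonnegative functions, so `f` is split into its positive and
  -- negative parts.
  let p : T → ENNReal := fun s => ENNReal.ofReal (f s)
  let q : T → ENNReal := fun s => ENNReal.ofReal (-f s)
  have hp : Measurable p := hf.ennreal_ofReal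
  have hq : Measurable q := hf.neg.ennreal_ofReal
  have hp' : ∫⁻ s, p s ∂(intensityMeasure T lam) ≠ ⊤ := hfi.lintegral_lt_top.ne
  have hq' : ∫⁻ s, q s ∂(intensityMeasure T lam) ≠ ⊤ := hfi.neg.lintegral_lt_top.ne
  have hpq (s : T) : p s * q s = 0 := by
    rcases le_total 0 (f s) with h | h
    · simp [q, h]
    · simp [p, h]
  have hsq (s : T) : ENNReal.ofReal (f s ^ 2) = p s * p s + q s * q s := by
    rcases le_total 0 (f s) with h | h
    · have hq0 : q s = 0 := ENNReal.ofReal_eq_zero.2 (neg_nonpos.2 h)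
      simp [p, hq0, sq, ENNReal.ofReal_mul h]
    · have hp0 : p s = 0 := ENNReal.ofReal_eq_zero.2 h
      rw [← neg_sq, hp0, sq, ENNReal.ofReal_mul (neg_nonneg.2 h)]
      simp [q]
  have hsum : ∫⁻ s, ENNReal.ofReal (f s ^ 2) ∂(intensityMeasure T lam) =
      ∫⁻ s, p s * p s ∂(intensityMeasure T lam) +
        ∫⁻ s, q s * q s ∂(intensityMeasure T lam) := by
    simp_rw [hsq]
    exact lintegral_add_left (hp.mul hp) _
  have hsumfin := hfsq.lintegral_lt_top.ne
  rw [hsum, ENNReal.add_ne_top] at hsumfin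
  obtain ⟨hpp, hqq⟩ := hsumfin
  let a : Ω → ℝ := fun ω => (∫⁻ s, p s ∂(X ω).toStieltjesFunction.measure).toReal
  let b : Ω → ℝ := fun ω => (∫⁻ s, q s ∂(X ω).toStieltjesFunction.measure).toReal
  have ha : Measurable a := (hX.measurable_lintegral hp).ennreal_toReal
  have hb : Measurable b := (hX.measurable_lintegral hq).ennreal_toReal
  obtain ⟨haa_int, haa⟩ := hX.integral_toReal_mul_toReal hlam hp hp hp' hp' hpp
  obtain ⟨hbb_int, hbb⟩ := hX.integral_toReal_mul_toReal hlam hq hq hq' hq' hqq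
  -- Since `p * q = 0`, the diagonal term vanishes and `a`, `b` are uncorrelated. In the variance
  -- all products of means cancel, leaving `∫ p² + ∫ q² = ∫ f²`.
  obtain ⟨hab_int, hab⟩ := hX.integral_toReal_mul_toReal hlam hp hq hp' hq' (by simp [hpq])
  have hmean {r : T → ENNReal} (hr : Measurable r)
      (hr' : ∫⁻ s, r s ∂(intensityMeasure T lam) ≠ ⊤) :
      ∫ ω, (∫⁻ s, r s ∂(X ω).toStieltjesFunction.measure).toReal ∂P =
        (∫⁻ s, r s ∂(intensityMeasure T lam)).toReal := by
    rw [integral_toReal (hX.measurable_lintegral hr).aemeasurable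
      (hX.ae_lintegral_lt_top hlam hr hr'), hX.lintegral_lintegral hlam hr]
  have haL : MemLp a 2 P := by
    rw [memLp_two_iff_integrable_sq ha.aestronglyMeasurable]
    simpa only [sq] using haa_int
  have hbL : MemLp b 2 P := by
    rw [memLp_two_iff_integrable_sq hb.aestronglyMeasurable]
    simpa only [sq] using hbb_int
  have hI : (fun ω => ∫ s, f s ∂(X ω).toStieltjesFunction.measure) =ᵐ[P] a - b := by
    filter_upwards [hX.ae_integrable hlam hf hfi] with ω hω
    exact integral_eq_lintegral_pos_part_sub_lintegral_neg_part hω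
  have hmeanI : ∫ ω, (a - b) ω ∂P = ∫ s, f s ∂(intensityMeasure T lam) := by
    rw [integral_sub' (haL.integrable one_le_two) (hbL.integrable one_le_two), hmean hp hp',
      hmean hq hq', integral_eq_lintegral_pos_part_sub_lintegral_neg_part hfi]
  refine ⟨(memLp_congr_ae hI).2 (haL.sub hbL), (integral_congr_ae hI).trans hmeanI, ?_⟩
  rw [variance_congr hI, variance_eq_sub (haL.sub hbL), hmeanI]
  have hsplit : ((a - b) ^ 2 : Ω → ℝ) = fun ω => a ω * a ω - 2 * (a ω * b ω) + b ω * b ω := by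
    ext ω
    simp only [Pi.pow_apply, Pi.sub_apply]
    ring
  have hsub_int : Integrable (fun ω => a ω * a ω - 2 * (a ω * b ω)) P :=
    haa_int.sub (hab_int.const_mul 2)
  rw [hsplit, integral_add hsub_int hbb_int, integral_sub haa_int (hab_int.const_mul 2),
    integral_const_mul, haa, hbb, hab,
    integral_eq_lintegral_of_nonneg_ae (ae_of_all _ fun s => sq_nonneg (f s))
      hfsq.aestronglyMeasurable, hsum, ENNReal.toReal_add hpp hqq,
    integral_eq_lintegral_pos_part_sub_lintegral_neg_part hfi]
  simp only [hpq, lintegral_zero, ENNReal.toReal_zero, p, q]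
  ring

end Campbell

/-! ### Linear images of Gaussian vectors -/

section Gaussian

variable {d : ℕ}

lemma charFun_map_inner {Ω : Type*} [MeasurableSpace Ω] {P : Measure Ω}
    {V : Ω → EuclideanSpace ℝ (Fin d)} (hV : AEMeasurable V P) (u : EuclideanSpace ℝ (Fin d)) :
    charFun (P.map V) u = charFun (P.map fun ω => inner ℝ u (V ω)) 1 := by
  rw [charFun_apply, charFun_apply, integral_map hV (by fun_prop),
    integral_map (by fun_prop) (by fun_prop)]
  simp [real_inner_comm]

lemma multivariateGaussian_map {S J : Matrix (Fin d) (Fin d) ℝ} (hS : S.PosSemidef)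
    {L : EuclideanSpace ℝ (Fin d) →L[ℝ] EuclideanSpace ℝ (Fin d)}
    (hL : ∀ x, (L x).ofLp = J.mulVec x.ofLp) :
    (multivariateGaussian 0 S).map L = multivariateGaussian 0 (J * S * J.transpose) := by
  have hJ : (J * S * J.transpose).PosSemidef := by
    simpa using hS.mul_mul_conjTranspose_same J
  have : IsProbabilityMeasure ((multivariateGaussian 0 S).map L) :=
    Measure.isProbabilityMeasure_map (by fun_prop)
  refine Measure.ext_of_charFun ?_
  ext t
  have hinner (x : EuclideanSpace ℝ (Fin d)) :
      inner ℝ (L x) t = inner ℝ x (WithLp.toLp 2 (J.transpose.mulVec t.ofLp)) := by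
    simp only [EuclideanSpace.inner_eq_star_dotProduct, star_trivial, hL]
    rw [Matrix.mulVec_transpose, ← Matrix.dotProduct_mulVec]
  rw [charFun_apply, integral_map (by fun_prop) (by fun_prop)]
  simp_rw [hinner]
  rw [← charFun_apply, charFun_multivariateGaussian hS, charFun_multivariateGaussian hJ]
  simp only [inner_zero_right, Complex.ofReal_zero, zero_mul]
  congr 4
  rw [← Matrix.mulVec_mulVec, ← Matrix.mulVec_mulVec, Matrix.mulVec_transpose,
    Matrix.dotProduct_mulVec t.ofLp J]

end Gaussian

/-! ### Multivariate central limit theorem and delta method -/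

section CentralLimitTheorem

variable {d : ℕ} {Ω : Type*} [MeasurableSpace Ω] {P : Measure Ω} [IsProbabilityMeasure P]

/-- The **central limit theorem** for square integrable random vectors. -/
theorem tendstoInDistribution_sqrt_smul_mean_sub {Z : ℕ → Ω → EuclideanSpace ℝ (Fin d)}
    {S : Matrix (Fin d) (Fin d) ℝ} (hZ : MemLp (Z 0) 2 P) (hindep : iIndepFun Z P)
    (hident : ∀ i, IdentDistrib (Z i) (Z 0) P P) (hS : S.PosSemidef)
    (hvar : ∀ u : EuclideanSpace ℝ (Fin d),
      Var[fun ω => inner ℝ u (Z 0 ω); P] = u.ofLp ⬝ᵥ S.mulVec u.ofLp) :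
    TendstoInDistribution
      (fun (n : ℕ) ω => √(n : ℝ) • ((n : ℝ)⁻¹ • ∑ j ∈ Finset.range n, Z j ω - P[Z 0]))
      atTop id (fun _ => P) (multivariateGaussian 0 S) := by
  have hmeas (n : ℕ) : AEMeasurable
      (fun ω => √(n : ℝ) • ((n : ℝ)⁻¹ • ∑ j ∈ Finset.range n, Z j ω - P[Z 0])) P := by
    have hsum : AEMeasurable (fun ω => ∑ j ∈ Finset.range n, Z j ω) P :=
      Finset.aemeasurable_fun_sum _ fun j _ => (hident j).aemeasurable_fst
    fun_prop
  refine ⟨hmeas, aemeasurable_id, ProbabilityMeasure.tendsto_iff_tendsto_charFun.2 fun u => ?_⟩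
  have hu : Measurable fun x : EuclideanSpace ℝ (Fin d) => inner ℝ u x := by fun_prop
  -- Cramér–Wold: the characteristic function at `u` is that of the projection on `u`, evaluated at
  -- `1`, so the real central limit theorem suffices.
  have hclt := tendstoInDistribution_inv_sqrt_mul_sum_sub (P := P)
    (X := fun j ω => inner ℝ u (Z j ω)) (Y := id)
    (P' := gaussianReal 0 Var[fun ω => inner ℝ u (Z 0 ω); P].toNNReal) HasLaw.id
    (hZ.const_inner u) (hindep.comp (fun _ x => inner ℝ u x) fun _ => hu)
    fun i => (hident i).comp hu
  have hlim := ProbabilityMeasure.tendsto_iff_tendsto_charFun.1 hclt.tendsto 1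
  simp only [ProbabilityMeasure.coe_mk, Measure.map_id] at hlim ⊢
  have hmean : ∫ ω, inner ℝ u (Z 0 ω) ∂P = inner ℝ u (P[Z 0]) :=
    integral_inner (hZ.integrable one_le_two) u
  convert! hlim using 2 with n
  · rw [charFun_map_inner (hmeas n)]
    congr 2
    ext ω
    rw [hmean, inner_smul_right, inner_sub_right, inner_smul_right, inner_sum]
    rcases Nat.eq_zero_or_pos n with rfl | hn
    · simp
    have hn' : (0 : ℝ) < n := by exact_mod_cast hn
    have hsq : √(n : ℝ) * √(n : ℝ) = n := Real.mul_self_sqrt hn'.le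
    have hs : √(n : ℝ) ≠ 0 := (Real.sqrt_pos.2 hn').ne'
    field_simp
    rw [sq, hsq]
  · rw [charFun_multivariateGaussian hS, charFun_gaussianReal, Real.coe_toNNReal _
      (variance_nonneg _ _), hvar]
    simp

/-- The **delta method**. -/
theorem TendstoInDistribution.delta_method {Ω' : Type*} [MeasurableSpace Ω'] {P' : Measure Ω'}
    [IsProbabilityMeasure P'] {a : ℕ → Ω → EuclideanSpace ℝ (Fin d)}
    {Z : Ω' → EuclideanSpace ℝ (Fin d)} {m : EuclideanSpace ℝ (Fin d)}
    {H : EuclideanSpace ℝ (Fin d) → EuclideanSpace ℝ (Fin d)}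
    {L : EuclideanSpace ℝ (Fin d) →L[ℝ] EuclideanSpace ℝ (Fin d)}
    (hH : Measurable H) (hL : HasFDerivAt H L m) (ha : ∀ n, AEMeasurable (a n) P)
    (hlim : ∀ᵐ ω ∂P, Tendsto (fun n => a n ω) atTop (𝓝 m))
    (hZ : TendstoInDistribution (fun (n : ℕ) ω => √(n : ℝ) • (a n ω - m)) atTop Z
      (fun _ => P) P') :
    TendstoInDistribution (fun (n : ℕ) ω => √(n : ℝ) • (H (a n ω) - H m)) atTop
      (fun ω => L (Z ω)) (fun _ => P) P' := by
  -- Normalised remainder of the first-order expansion of `H` at `m`; `e m = 0` since `0⁻¹ = 0`.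
  let e : EuclideanSpace ℝ (Fin d) → EuclideanSpace ℝ (Fin d) :=
    fun x => ‖x - m‖⁻¹ • (H x - H m - L (x - m))
  have he : Measurable e := by fun_prop
  have he0 : Tendsto e (𝓝 m) (𝓝 0) := by
    rw [tendsto_zero_iff_norm_tendsto_zero]
    have := hasFDerivAt_iff_tendsto.1 hL
    simpa [e, norm_smul] using this
  have hem : TendstoInMeasure P (fun n ω => e (a n ω)) atTop fun _ => 0 :=
    tendstoInMeasure_of_tendsto_ae
      (fun n => (he.comp_aemeasurable (ha n)).aestronglyMeasurable)
      (hlim.mono fun ω hω => he0.comp hω)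
  -- Slutsky: with `Y = √n (a_n - m)`, the scaled difference equals `L Y + ‖Y‖ e(a_n)`, and `e(a_n)`
  -- tends to `0`.
  have h := hZ.continuous_comp_prodMk_of_tendstoInMeasure_const
    (g := fun y : EuclideanSpace ℝ (Fin d) × EuclideanSpace ℝ (Fin d) => L y.1 + ‖y.1‖ • y.2)
    (by fun_prop) hem fun n => he.comp_aemeasurable (ha n)
  convert! h using 1
  · ext1 n
    ext1 ω
    simp only [e, map_smul, norm_smul, Real.norm_of_nonneg (Real.sqrt_nonneg _), smul_smul]
    rcases eq_or_ne (a n ω) m with heq | hne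
    · simp [heq]
    · have : ‖a n ω - m‖ ≠ 0 := norm_ne_zero_iff.2 (sub_ne_zero.2 hne)
      rw [mul_inv_cancel_right₀ this, ← smul_add]
      simp
  · simp

end CentralLimitTheorem

/-! ### Moments of the integrals and the main theorem -/

section MethodOfMoments

variable {d : ℕ} {T : Set ℝ}
  {lam : EuclideanSpace ℝ (Fin d) → ℝ → ℝ} {g : ℝ → EuclideanSpace ℝ (Fin d)}
  {θ : EuclideanSpace ℝ (Fin d)}

lemma smul_inner_sq_eq_sum (u x : EuclideanSpace ℝ (Fin d)) (c : ℝ) :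
    c • inner ℝ u x ^ 2 = ∑ l, ∑ k, u l * u k * (x l * x k * c) := by
  have h : inner ℝ u x = ∑ i, u i * x i := by simp [PiLp.inner_apply, mul_comm]
  rw [h, sq, Finset.sum_mul_sum, Finset.smul_sum]
  refine Finset.sum_congr rfl fun l _ => ?_
  rw [Finset.smul_sum]
  refine Finset.sum_congr rfl fun k _ => ?_
  simp only [smul_eq_mul]
  ring

lemma integrableOn_smul_inner_sq
    (hG : ∀ l k, IntegrableOn (fun s => g s l * g s k * lam θ s) T)
    (u : EuclideanSpace ℝ (Fin d)) : IntegrableOn (fun s => lam θ s • inner ℝ u (g s) ^ 2) T := by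
  simp_rw [smul_inner_sq_eq_sum]
  exact integrable_finsetSum _ fun l _ => integrable_finsetSum _ fun k _ => (hG l k).const_mul _

lemma dotProduct_momentCov_mulVec
    (hG : ∀ l k, IntegrableOn (fun s => g s l * g s k * lam θ s) T)
    (u : EuclideanSpace ℝ (Fin d)) :
    u.ofLp ⬝ᵥ (momentCov T lam g θ).mulVec u.ofLp = ∫ s in T, lam θ s • inner ℝ u (g s) ^ 2 := by
  simp_rw [smul_inner_sq_eq_sum]
  rw [integral_finsetSum _ fun l _ =>
    integrable_finsetSum _ fun k _ => (hG l k).const_mul _]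
  simp only [dotProduct, Matrix.mulVec, Finset.mul_sum]
  refine Finset.sum_congr rfl fun l _ => ?_
  rw [integral_finsetSum _ fun k _ => (hG l k).const_mul _]
  refine Finset.sum_congr rfl fun k _ => ?_
  rw [integral_const_mul, momentCov, Matrix.of_apply]
  ring

lemma posSemidef_momentCov [T.OrdConnected] (hlam : IsIntensity T (lam θ))
    (hG : ∀ l k, IntegrableOn (fun s => g s l * g s k * lam θ s) T) :
    (momentCov T lam g θ).PosSemidef := by
  refine Matrix.PosSemidef.of_dotProduct_mulVec_nonneg ?_ fun x => ?_
  · ext l k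
    simp [momentCov, mul_comm (g _ l)]
  · have h := dotProduct_momentCov_mulVec hG (WithLp.toLp 2 x)
    rw [star_trivial, h]
    exact setIntegral_nonneg (measurableSet_of_ordConnected T) fun s hs =>
      mul_nonneg (hlam.nonneg s hs) (sq_nonneg _)

lemma fderiv_ofLp_eq_jacobian_mulVec
    (H : EuclideanSpace ℝ (Fin d) → EuclideanSpace ℝ (Fin d)) (a x : EuclideanSpace ℝ (Fin d)) :
    (fderiv ℝ H a x).ofLp = (jacobian H a).mulVec x.ofLp := by
  have hx : x = ∑ k, x k • EuclideanSpace.single k (1 : ℝ) := by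
    ext i
    simp [Pi.single_apply]
  ext l
  conv_lhs => rw [hx]
  simp [jacobian, Matrix.mulVec, dotProduct, mul_comm]

variable [T.OrdConnected] {Ω : Type*} [MeasurableSpace Ω] {P : Measure Ω}
  {X : Ω → CountingPath T}

/-- The inner product passes under the integral on paths where `g` is integrable; by Campbell's
formula these are almost all paths. -/
lemma IsPoissonProcess.inner_integral_ae_eq (hlam : IsIntensity T (lam θ)) (hg : Measurable g)
    (hM : IntegrableOn (fun s => lam θ s • g s) T) (hX : IsPoissonProcess X (lam θ) P)
    (u : EuclideanSpace ℝ (Fin d)) :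
    (fun ω => inner ℝ u ((X ω).integral g)) =ᵐ[P]
      fun ω => ∫ s : T, inner ℝ u (g s) ∂(X ω).toStieltjesFunction.measure := by
  filter_upwards [hX.ae_integrable hlam (hg.comp measurable_subtype_coe)
    ((hlam.integrable_intensityMeasure_iff g).2 hM)] with ω hω
  exact (integral_inner hω u).symm

/-- The integral of `g` along a Poisson process is square integrable, with mean `M` and
covariance matrix `G`. -/
lemma IsPoissonProcess.moments_integral [IsProbabilityMeasure P]
    (hlam : IsIntensity T (lam θ)) (hg : Measurable g)
    (hM : IntegrableOn (fun s => lam θ s • g s) T)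
    (hG : ∀ l k, IntegrableOn (fun s => g s l * g s k * lam θ s) T)
    (hX : IsPoissonProcess X (lam θ) P) :
    MemLp (fun ω => (X ω).integral g) 2 P ∧ ∫ ω, (X ω).integral g ∂P = momentMap T lam g θ ∧
      ∀ u : EuclideanSpace ℝ (Fin d), Var[fun ω => inner ℝ u ((X ω).integral g); P] =
        u.ofLp ⬝ᵥ (momentCov T lam g θ).mulVec u.ofLp := by
  have hgT : Integrable (fun s : T => g s) (intensityMeasure T (lam θ)) :=
    (hlam.integrable_intensityMeasure_iff g).2 hM
  -- Scalar Campbell formulas for all projections `⟨u, g⟩` determine the mean vector and the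
  -- covariance form.
  have hcamp (u : EuclideanSpace ℝ (Fin d)) :=
    hX.memLp_mean_variance_integral hlam (f := fun s : T => inner ℝ u (g s)) (by fun_prop)
      (hgT.const_inner u) ((hlam.integrable_intensityMeasure_iff fun s => inner ℝ u (g s) ^ 2).2
        (integrableOn_smul_inner_sq hG u))
  have hae := hX.inner_integral_ae_eq hlam hg hM
  have hmem : MemLp (fun ω => (X ω).integral g) 2 P := by
    refine MemLp.of_eval_piLp fun i => ?_
    have := (memLp_congr_ae (hae (EuclideanSpace.single i 1))).2 (hcamp _).1
    simpa [EuclideanSpace.inner_single_left] using this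
  refine ⟨hmem, ?_, fun u => ?_⟩
  · refine ext_inner_left ℝ fun u => ?_
    rw [← integral_inner (hmem.integrable one_le_two), integral_congr_ae (hae u), (hcamp u).2.1,
      integral_inner hgT, hlam.integral_intensityMeasure g, momentMap]
  · rw [variance_congr (hae u), (hcamp u).2.2, dotProduct_momentCov_mulVec hG,
      hlam.integral_intensityMeasure fun s => inner ℝ u (g s) ^ 2]

end MethodOfMoments

theorem theorem1 {d : ℕ} (T : Set ℝ) [T.OrdConnected]
    (Θ : Set (EuclideanSpace ℝ (Fin d)))
    (hΘ_open : IsOpen Θ) (hΘ_convex : Convex ℝ Θ) (hΘ_bdd : Bornology.IsBounded Θ)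
    (lam : EuclideanSpace ℝ (Fin d) → ℝ → ℝ) (hlam : ∀ θ ∈ Θ, IsIntensity T (lam θ))
    (g : ℝ → EuclideanSpace ℝ (Fin d)) (hg : Measurable g)
    -- the integrals that define `M` on `Θ` and `G` at the true value are finite
    (hM : ∀ θ ∈ Θ, IntegrableOn (fun s => lam θ s • g s) T)
    (θ₀ : EuclideanSpace ℝ (Fin d)) (hθ₀ : θ₀ ∈ Θ)
    (hG : ∀ l k, IntegrableOn (fun s => g s l * g s k * lam θ₀ s) T)
    (H : EuclideanSpace ℝ (Fin d) → EuclideanSpace ℝ (Fin d)) (hH : Measurable H)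
    (hreg : RegularityConditions Θ (momentMap T lam g) H)
    {Ω : Type*} [MeasurableSpace Ω] (P : Measure Ω) [IsProbabilityMeasure P]
    -- independent Poisson processes with the same intensity `λ(θ₀, ·)`
    (X : ℕ → Ω → CountingPath T)
    (hX : ∀ j, IsPoissonProcess (X j) (lam θ₀) P)
    (hindep : iIndepFun (fun j ω (t : T) => (X j ω).toFun t) P) :
    TendstoInMeasure P (momentEstimator X g H) atTop (fun _ => θ₀) ∧
    TendstoInDistribution (fun (n : ℕ) ω => √(n : ℝ) • (momentEstimator X g H n ω - θ₀))
      atTop id (fun _ => P) (multivariateGaussian 0 (limitCov T lam g H θ₀)) := by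
  have hlam₀ := hlam θ₀ hθ₀
  obtain ⟨hmem, hmean, hvar⟩ := (hX 0).moments_integral hlam₀ hg (hM θ₀ hθ₀) hG
  have hident (i : ℕ) := (hX i).identDistrib_integral (hX 0) hg
  have hindep' : iIndepFun (fun j ω => (X j ω).integral g) P :=
    iIndepFun_countingPath_integral hg hindep
  have hHM : H (momentMap T lam g θ₀) = θ₀ := hreg.leftInvOn hθ₀
  obtain ⟨U, hU, hMU, hHU⟩ := hreg.contDiffOn
  have hdiff : DifferentiableAt ℝ H (momentMap T lam g θ₀) :=
    (hHU.differentiableOn one_ne_zero).differentiableAt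
      (hU.mem_nhds (hMU (Set.mem_image_of_mem _ hθ₀)))
  have hameas (n : ℕ) : Measurable (empiricalMoment X g n) := by
    have := fun j => (hX j).measurable_integral hg
    unfold empiricalMoment
    fun_prop
  have hlln : ∀ᵐ ω ∂P, Tendsto (fun n => empiricalMoment X g n ω) atTop
      (𝓝 (momentMap T lam g θ₀)) := by
    rw [← hmean]
    exact strong_law_ae (fun j ω => (X j ω).integral g) (hmem.integrable one_le_two)
      (fun i j hij => hindep'.indepFun hij) hident
  refine ⟨tendstoInMeasure_of_tendsto_ae
    (fun n => (hH.comp (hameas n)).aestronglyMeasurable) ?_, ?_⟩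
  · filter_upwards [hlln] with ω hω
    have h := hdiff.continuousAt.tendsto.comp hω
    rwa [hHM] at h
  · have hpsd := posSemidef_momentCov hlam₀ hG
    have hclt := tendstoInDistribution_sqrt_smul_mean_sub hmem hindep' hident hpsd hvar
    rw [hmean] at hclt
    have hdelta := TendstoInDistribution.delta_method hH hdiff.hasFDerivAt
      (fun n => (hameas n).aemeasurable) hlln hclt
    rw [hHM] at hdelta
    refine ⟨hdelta.forall_aemeasurable, aemeasurable_id, ?_⟩
    convert! hdelta.tendsto using 2
    refine congrArg 𝓝 (Subtype.ext ?_)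
    simp only [Measure.map_id, id]
    exact (multivariateGaussian_map hpsd (fderiv_ofLp_eq_jacobian_mulVec H _)).symm
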